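/- **Theorem 4.1.** Let $\mathbb{K}$ be a field of characteristic $0$. For $\mathbf d=(d_1,\dots,d_s)$ let $\mathbb{K}[X_{\mathbf d}]$ be the polynomial algebra in the variables $x_i^{(k)}$, $1\le k\le s$, $0\le i\le d_k$, with its usual grading by degree, and let $\mathcal D_{\mathbf d}$ and $\mathcal D_{\mathbf d}^*$ be the $\mathbb K$-derivations of $\mathbb{K}[X_{\mathbf d}]$ given by $$\mathcal D_{\mathbf d}(x_i^{(k)})=i\,x_{i-1}^{(k)},\qquad \mathcal D_{\mathbf d}^*(x_i^{(k)})=(d_k-i)\,x_{i+1}^{(k)}$$ (so $\mathcal D_{\mathbf d}(x_0^{(k)})=0$ and $\mathcal D_{\mathbf d}^*(x_{d_k}^{(k)})=0$). Let $\mathcal I_{\mathbf d}=\ker\mathcal D_{\mathbf d}\cap\ker\mathcal D_{\mathbf d}^*$ be the graded algebra of joint invariants and $\mathcal S_{\mathbf d}=\ker\mathcal D_{\mathbf d}$ the graded algebra of joint semi-invariants of binary forms of degrees $d_1,\dots,d_s$, with Poincaré series $$\mathcal{PI}_{\mathbf d}(z)=\sum_{m\ge 0}\dim\big((\mathcal I_{\mathbf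 d})_m\big)z^m,\qquad \mathcal{PS}_{\mathbf d}(z)=\sum_{m\ge 0}\dim\big((\mathcal S_{\mathbf d})_m\big)z^m.$$ Let $n\ge 1$ and $\mathbf d=(1,1,\dots,1)$ with $n$ entries. Then, as formal power series in $z$, $$\mathcal{PI}_{\mathbf d}(z)=\sum_{k=1}^n\frac{(-1)^{n-k}}{(k-1)!}\,\frac{(n)_{n-k}}{(n-k)!}\,\frac{d^{k-1}}{dz^{k-1}}\left(\left(\frac{z}{1-z^2}\right)^{2n-k-1}\right),$$ $$\mathcal{PS}_{\mathbf d}(z)=\sum_{k=1}^n\frac{(-1)^{n-k}}{(k-1)!}\,\frac{(n)_{n-k}}{(n-k)!}\,\frac{d^{k-1}}{dz^{k-1}}\left(\frac{(1+z)z^{2n-k-1}}{(1-z^2)^{2n-k}}\right),$$ where $(n)_m:=n(n+1)\cdots(n+m-1)$, $(n)_0:=1$, denotes the shifted factorial. -/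

import Mathlib

noncomputable section

namespace JointInvariants

/-- The index set of the variables `x_i^{(k)}`, `k < s`, `0 ≤ i ≤ d_k`. -/
abbrev Vars {s : ℕ} (d : Fin s → ℕ) : Type := Σ k : Fin s, Fin (d k + 1)

variable (K : Type*) [Field K] {s : ℕ} (d : Fin s → ℕ)

/-- The Weitzenböck derivation `x_i^{(k)} ↦ i x_{i-1}^{(k)}`, which is `0` on `x_0^{(k)}`. -/
def weitzenbockDerivation : Derivation K (MvPolynomial (Vars d) K) (MvPolynomial (Vars d) K) :=
  MvPolynomial.mkDerivation K fun v : Vars d =>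
    (v.2 : ℕ) • MvPolynomial.X (⟨v.1, ⟨(v.2 : ℕ) - 1, by omega⟩⟩ : Vars d)

/-- The dual derivation `x_i^{(k)} ↦ (d_k - i) x_{i+1}^{(k)}`, which is `0` on `x_{d_k}^{(k)}`. -/
def dualDerivation : Derivation K (MvPolynomial (Vars d) K) (MvPolynomial (Vars d) K) :=
  MvPolynomial.mkDerivation K fun v : Vars d =>
    if h : (v.2 : ℕ) + 1 < d v.1 + 1 then
      (d v.1 - (v.2 : ℕ)) • MvPolynomial.X (⟨v.1, ⟨(v.2 : ℕ) + 1, h⟩⟩ : Vars d)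
    else 0

/-- The kernel of a derivation, as a subalgebra. -/
def derivationKer {A : Type*} [CommRing A] [Algebra K A] (D : Derivation K A A) :
    Subalgebra K A where
  carrier := {v | D v = 0}
  mul_mem' {a b} ha hb := by
    have ha' : D a = 0 := ha
    have hb' : D b = 0 := hb
    simp [ha', hb']
  add_mem' {a b} ha hb := by
    have ha' : D a = 0 := ha
    have hb' : D b = 0 := hb
    simp [ha', hb']
  algebraMap_mem' r := by simp

/-- The algebra of joint semi-invariants: the kernel of the Weitzenböck derivation. -/
def semiInvariants : Subalgebra K (MvPolynomial (Vars d) K) :=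
  derivationKer K (weitzenbockDerivation K d)

/-- The algebra of joint invariants: the polynomials killed by both derivations. -/
def invariants : Subalgebra K (MvPolynomial (Vars d) K) :=
  derivationKer K (weitzenbockDerivation K d) ⊓ derivationKer K (dualDerivation K d)

variable {K}

/-- The homogeneous component of degree `m` of a subalgebra of a polynomial ring. -/
def gradedPiece {σ : Type*} (A : Subalgebra K (MvPolynomial σ K)) (m : ℕ) :
    Submodule K (MvPolynomial σ K) :=
  Subalgebra.toSubmodule A ⊓ MvPolynomial.homogeneousSubmodule σ K m

/-- The Poincaré series `∑ dim(A_m) z^m`. As there are finitely many variables, every homogeneous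
component is finite-dimensional. -/
def poincareSeries {σ : Type*} [Finite σ] (A : Subalgebra K (MvPolynomial σ K)) :
    PowerSeries ℚ :=
  PowerSeries.mk fun m => (Module.finrank K (gradedPiece A m) : ℚ)

variable (K)

/-- The Poincaré series of the algebra of joint invariants. -/
def PI : PowerSeries ℚ := poincareSeries (invariants K d)

/-- The Poincaré series of the algebra of joint semi-invariants. -/
def PS : PowerSeries ℚ := poincareSeries (semiInvariants K d)

end JointInvariants

end

/-! Write `E` and `F` for the two derivations and `V a b` for the polynomials of degree `a` in the
`x_0^{(k)}` and `b` in the `x_1^{(k)}`. On `V a b` the commutator `[E, F]` is the scalar `a - b`, so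
sl₂ theory makes `E : V a (b+1) → V (a+1) b` surjective for `b ≤ a`, and `E` injective on `V a b`
for `a < b` (`map_E_eq`, `eq_zero_of_E_eq_zero`). Kernel dimensions are therefore differences of
products of multiset counts. They telescope to a single product for semi-invariants
(`finrank_semiInvariants`); invariants are `ker E` on the diagonal `V p p`
(`gradedPiece_invariants_even`). On the series side put `N = n - 1`, `i = n - k`: each coefficient
of the right-hand sides is an alternating sum of triple products of binomials, or a difference of
two such sums, which `sum_alternating_choose_mul` evaluates to the same products. -/

/-! ### Bigraded sl₂ operators. -/

section Abstract

variable {K M : Type*} [Field K] [AddCommGroup M] [Module K M]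

/-- A bigraded family of subspaces with operators of bidegrees `(1, -1)` and `(-1, 1)` satisfying
the commutation relation of `sl₂` on each bihomogeneous part. -/
structure BigradedSl2 (V : ℕ → ℕ → Submodule K M) (E F : M →ₗ[K] M) : Prop where
  map_E : ∀ {a b v}, v ∈ V a (b + 1) → E v ∈ V (a + 1) b
  E_zero : ∀ {a v}, v ∈ V a 0 → E v = 0
  map_F : ∀ {a b v}, v ∈ V (a + 1) b → F v ∈ V a (b + 1)
  F_zero : ∀ {b v}, v ∈ V 0 b → F v = 0
  comm : ∀ {a b v}, v ∈ V a b → E (F v) - F (E v) = ((a : K) - b) • v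

namespace BigradedSl2

variable {V : ℕ → ℕ → Submodule K M} {E F : M →ₗ[K] M}

theorem swap (h : BigradedSl2 V E F) : BigradedSl2 (fun a b => V b a) F E where
  map_E := h.map_F
  E_zero := h.F_zero
  map_F := h.map_E
  F_zero := h.E_zero
  comm {a b v} hv := by
    rw [← neg_sub, h.comm hv, ← neg_smul, neg_sub]

theorem ker_inf_zero (h : BigradedSl2 V E F) (a : ℕ) : LinearMap.ker E ⊓ V a 0 = V a 0 :=
  inf_eq_right.2 fun _ hv => h.E_zero hv

variable [CharZero K]

/-- `F E` has no negative integer eigenvalue here: `E v` would again be an eigenvector of `F E`,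
with a still more negative eigenvalue, and repeated application of `E` ends at `b = 0`, where `E`
vanishes. -/
theorem eq_zero_of_F_E_eq (h : BigradedSl2 V E F) {b : ℕ} :
    ∀ {a c : ℕ} {v : M}, v ∈ V a b → b ≤ a → 0 < c → F (E v) = -(c : K) • v → v = 0 := by
  induction b with
  | zero =>
    intro a c v hv _ hc hFE
    rw [h.E_zero hv, map_zero, eq_comm, smul_eq_zero] at hFE
    refine hFE.resolve_left ?_
    simpa using hc.ne'
  | succ b ih =>
    intro a c v hv hba hc hFE
    have hEv : E v = 0 := by
      -- `E F (E v) = -c • E v`, and exchanging `E` and `F` on `V (a+1) b` subtracts the weight `a +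
      -- 1 - b`.
      refine ih (a := a + 1) (c := c + (a + 1 - b)) (h.map_E hv) (by omega) (by omega) ?_
      have h1 := h.comm (h.map_E hv)
      rw [hFE, map_smul] at h1
      rw [sub_eq_iff_eq_add'] at h1
      rw [← sub_eq_iff_eq_add, ← sub_smul] at h1
      rw [← h1, Nat.cast_add c, Nat.cast_sub (by omega)]
      congr 1
      push_cast
      ring
    rw [hEv, map_zero, eq_comm, smul_eq_zero] at hFE
    refine hFE.resolve_left ?_
    simpa using hc.ne'

theorem eq_zero_of_E_F_eq_zero (h : BigradedSl2 V E F) {a b : ℕ} {v : M} (hv : v ∈ V a b)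
    (hab : b < a) (hEF : E (F v) = 0) : v = 0 := by
  refine h.eq_zero_of_F_E_eq (c := a - b) hv hab.le (by omega) ?_
  have h1 := h.comm hv
  rw [hEF, zero_sub] at h1
  rw [neg_smul, Nat.cast_sub hab.le, ← h1, neg_neg]

theorem eq_zero_of_E_eq_zero (h : BigradedSl2 V E F) {a b : ℕ} {v : M} (hv : v ∈ V a b)
    (hab : a < b) (hE : E v = 0) : v = 0 :=
  h.swap.eq_zero_of_E_F_eq_zero (a := b) (b := a) hv hab (by rw [hE, map_zero])

theorem map_E_eq (h : BigradedSl2 V E F) [∀ a b, Module.Finite K (V a b)] {a b : ℕ}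
    (hab : b ≤ a) : (V a (b + 1)).map E = V (a + 1) b := by
  apply le_antisymm
  · rintro _ ⟨v, hv, rfl⟩
    exact h.map_E hv
  · intro w hw
    -- `E F` is an injective endomorphism of a finite-dimensional space, hence onto; so `E` is onto,
    -- with preimages of the form `F v`.
    let g : V (a + 1) b →ₗ[K] V (a + 1) b :=
      (E ∘ₗ F).restrict fun v hv => h.map_E (h.map_F hv)
    have hg : Function.Injective g := by
      rw [← LinearMap.ker_eq_bot, LinearMap.ker_eq_bot']
      intro v hv
      exact Subtype.ext
        (h.eq_zero_of_E_F_eq_zero v.2 (by omega) (congrArg Subtype.val hv))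
    obtain ⟨v, hv⟩ := LinearMap.surjective_of_injective hg ⟨w, hw⟩
    exact ⟨F v, h.map_F v.2, congrArg Subtype.val hv⟩

theorem finrank_ker_inf_add (h : BigradedSl2 V E F) [∀ a b, Module.Finite K (V a b)] {a b : ℕ}
    (hab : b ≤ a) :
    Module.finrank K ↥(LinearMap.ker E ⊓ V a (b + 1)) + Module.finrank K (V (a + 1) b) =
      Module.finrank K (V a (b + 1)) := by
  have h1 := LinearMap.finrank_range_add_finrank_ker (E.domRestrict (V a (b + 1)))
  rw [LinearMap.range_domRestrict, h.map_E_eq hab, LinearMap.ker_domRestrict] at h1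
  rw [← h1, add_comm, inf_comm, ← Submodule.map_comap_subtype,
    (Submodule.equivSubtypeMap _ _).finrank_eq]

theorem ker_inf_eq_bot (h : BigradedSl2 V E F) {a b : ℕ} (hab : a < b) :
    LinearMap.ker E ⊓ V a b = ⊥ :=
  (Submodule.eq_bot_iff _).2 fun _ hv => h.eq_zero_of_E_eq_zero hv.2 hab hv.1

/-- In weight zero `E F v = F E v = 0`, while `E` is injective on the piece containing `F v`. -/
theorem F_eq_zero_of_E_eq_zero (h : BigradedSl2 V E F) {a : ℕ} {v : M} (hv : v ∈ V a a)
    (hE : E v = 0) : F v = 0 := by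
  cases a with
  | zero => exact h.F_zero hv
  | succ a =>
    refine h.eq_zero_of_E_eq_zero (h.map_F hv) (by omega) ?_
    simpa [hE] using h.comm hv

end BigradedSl2

/-- Dimension count from a finite family of projections onto a direct sum decomposition. -/
theorem finrank_eq_sum_of_projections {ι : Type*} [DecidableEq ι] (s : Finset ι)
    (S : Submodule K M) (T : ι → Submodule K M) (P : ι → M →ₗ[K] M)
    [∀ i, Module.Finite K (T i)]
    (hT : ∀ i ∈ s, T i ≤ S) (hP : ∀ i ∈ s, ∀ v ∈ S, P i v ∈ T i)
    (hsame : ∀ i ∈ s, ∀ v ∈ T i, P i v = v)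
    (hne : ∀ i ∈ s, ∀ j ∈ s, i ≠ j → ∀ v ∈ T j, P i v = 0)
    (hsum : ∀ v ∈ S, ∑ i ∈ s, P i v = v) :
    Module.finrank K S = ∑ i ∈ s, Module.finrank K (T i) := by
  let e : S ≃ₗ[K] (∀ i : s, T i) :=
    { toFun := fun v i => ⟨P i v, hP i i.2 v v.2⟩
      map_add' := fun v w => by ext i; simp
      map_smul' := fun c v => by ext i; simp
      invFun := fun f => ⟨∑ i : s, (f i : M), S.sum_mem fun i _ => hT i i.2 (f i).2⟩
      left_inv := fun v => Subtype.ext <| by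
        simpa using (Finset.sum_coe_sort s fun i => P i v).trans (hsum v v.2)
      right_inv := fun f => by
        ext i
        simp only [map_sum]
        rw [Finset.sum_eq_single i]
        · exact hsame i i.2 _ (f i).2
        · intro j _ hj
          exact hne i i.2 j j.2 (fun h => hj (Subtype.ext h.symm)) _ (f j).2
        · simp }
  rw [e.finrank_eq, Module.finrank_pi_fintype, Finset.sum_coe_sort s fun i => Module.finrank K (T i)]

end Abstract

/-! ### The sl₂ action on polynomials in the coefficients of linear forms. -/

namespace JointInvariants

open MvPolynomial

/-- The variables of `n` linear forms. -/
abbrev LinVars (n : ℕ) : Type := Vars (fun _ : Fin n => 1)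

/-- The bidegree of a variable: `(1, 0)` for `x_0^{(k)}` and `(0, 1)` for `x_1^{(k)}`. -/
def bidegreeWeight (n : ℕ) (v : LinVars n) : ℕ × ℕ := if v.2 = 0 then (1, 0) else (0, 1)

variable {n : ℕ}

theorem sum_linVars {A : Type*} [AddCommMonoid A] (g : LinVars n → A) :
    ∑ v, g v = ∑ k, g ⟨k, 0⟩ + ∑ k, g ⟨k, 1⟩ := by
  rw [Fintype.sum_sigma, ← Finset.sum_add_distrib]
  exact Finset.sum_congr rfl fun k _ => Fin.sum_univ_two _

theorem weight_bidegreeWeight (f : LinVars n →₀ ℕ) :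
    Finsupp.weight (bidegreeWeight n) f = (∑ k, f ⟨k, 0⟩, ∑ k, f ⟨k, 1⟩) := by
  rw [Finsupp.weight_apply, Finsupp.sum_fintype _ _ (by simp), sum_linVars]
  ext <;> simp [bidegreeWeight, Prod.fst_sum, Prod.snd_sum]

theorem degree_eq_weight (f : LinVars n →₀ ℕ) :
    f.degree = (Finsupp.weight (bidegreeWeight n) f).1 +
      (Finsupp.weight (bidegreeWeight n) f).2 := by
  rw [weight_bidegreeWeight, Finsupp.degree_eq_sum, sum_linVars]

variable (K : Type*) [Field K]

/-- The polynomials which are bihomogeneous of bidegree `(a, b)`. -/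
noncomputable def bihomogeneous (n a b : ℕ) : Submodule K (MvPolynomial (LinVars n) K) :=
  weightedHomogeneousSubmodule K (bidegreeWeight n) (a, b)

variable {K} in
theorem derivation_sum_apply {A ι : Type*} [CommRing A] [Algebra K A] (s : Finset ι)
    (D : ι → Derivation K A A) (x : A) : (∑ i ∈ s, D i) x = ∑ i ∈ s, D i x := by
  classical
  induction s using Finset.induction_on with
  | empty => simp
  | insert i s hi ih => rw [Finset.sum_insert hi, Finset.sum_insert hi, Derivation.add_apply, ih]

theorem weitzenbockDerivation_apply (p : MvPolynomial (LinVars n) K) :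
    weitzenbockDerivation K (fun _ : Fin n => 1) p =
      ∑ k, X ⟨k, 0⟩ * pderiv ⟨k, 1⟩ p := by
  have h : weitzenbockDerivation K (fun _ : Fin n => 1) =
      ∑ k, (X ⟨k, 0⟩ : MvPolynomial (LinVars n) K) • pderiv (R := K) ⟨k, 1⟩ := by
    refine MvPolynomial.derivation_ext fun ⟨k, i⟩ => ?_
    rw [weitzenbockDerivation, mkDerivation_X, derivation_sum_apply]
    fin_cases i <;> simp [Pi.single_apply, pderiv_X]
  rw [h, derivation_sum_apply]
  simp

theorem dualDerivation_apply (p : MvPolynomial (LinVars n) K) :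
    dualDerivation K (fun _ : Fin n => 1) p =
      ∑ k, X ⟨k, 1⟩ * pderiv ⟨k, 0⟩ p := by
  have h : dualDerivation K (fun _ : Fin n => 1) =
      ∑ k, (X ⟨k, 1⟩ : MvPolynomial (LinVars n) K) • pderiv (R := K) ⟨k, 0⟩ := by
    refine MvPolynomial.derivation_ext fun ⟨k, i⟩ => ?_
    rw [dualDerivation, mkDerivation_X, derivation_sum_apply]
    fin_cases i <;> simp [Pi.single_apply, pderiv_X]
  rw [h, derivation_sum_apply]
  simp

theorem pderiv_eq_zero_of_weight {σ : Type*} {w : σ → ℕ × ℕ} {c : ℕ × ℕ}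
    {v : MvPolynomial σ K} (hv : IsWeightedHomogeneous w v c) (i : σ) (hi : ¬ w i ≤ c) :
    pderiv i v = 0 := by
  refine pderiv_eq_zero_of_notMem_vars fun hmem => hi ?_
  obtain ⟨f, hf, hif⟩ := mem_vars_iff_mem_support i |>.1 hmem
  rw [← hv (mem_support_iff.1 hf)]
  exact Finsupp.le_weight_of_ne_zero' w (Finsupp.mem_support_iff.1 hif)

theorem bidegreeWeight_zero (k : Fin n) : bidegreeWeight n ⟨k, 0⟩ = (1, 0) := rfl

theorem bidegreeWeight_one (k : Fin n) : bidegreeWeight n ⟨k, 1⟩ = (0, 1) := rfl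

theorem commutator_apply (p : MvPolynomial (LinVars n) K) :
    weitzenbockDerivation K (fun _ : Fin n => 1) (dualDerivation K (fun _ : Fin n => 1) p) -
      dualDerivation K (fun _ : Fin n => 1) (weitzenbockDerivation K (fun _ : Fin n => 1) p) =
    ∑ k, X ⟨k, 0⟩ * pderiv ⟨k, 0⟩ p - ∑ k, X ⟨k, 1⟩ * pderiv ⟨k, 1⟩ p := by
  have h : ⁅weitzenbockDerivation K (fun _ : Fin n => 1), dualDerivation K (fun _ : Fin n => 1)⁆ =
      ∑ k, (X ⟨k, 0⟩ : MvPolynomial (LinVars n) K) • pderiv (R := K) ⟨k, 0⟩ -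
      ∑ k, (X ⟨k, 1⟩ : MvPolynomial (LinVars n) K) • pderiv (R := K) ⟨k, 1⟩ := by
    refine MvPolynomial.derivation_ext fun ⟨k, i⟩ => ?_
    rw [Derivation.commutator_apply]
    simp only [weitzenbockDerivation_apply, dualDerivation_apply, Derivation.sub_apply,
      derivation_sum_apply]
    fin_cases i <;> simp [Pi.single_apply, pderiv_X]
  rw [← Derivation.commutator_apply, h, Derivation.sub_apply, derivation_sum_apply,
    derivation_sum_apply]
  simp

theorem coeff_X_mul_pderiv {σ : Type*} (i : σ) (p : MvPolynomial σ K) (f : σ →₀ ℕ) :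
    coeff f (X i * pderiv i p) = (f i : K) * coeff f p := by
  classical
  induction p using MvPolynomial.induction_on' with
  | monomial g r =>
    rw [X_mul_pderiv_monomial, coeff_smul, coeff_monomial, nsmul_eq_mul]
    split_ifs with h
    · rw [h]
    · simp
  | add p q hp hq => rw [map_add, mul_add, coeff_add, coeff_add, hp, hq, mul_add]

/-- The commutator is a difference of two Euler operators, hence diagonal on monomials. -/
theorem coeff_commutator (p : MvPolynomial (LinVars n) K) (f : LinVars n →₀ ℕ) :
    coeff f (weitzenbockDerivation K (fun _ : Fin n => 1)
        (dualDerivation K (fun _ : Fin n => 1) p) -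
      dualDerivation K (fun _ : Fin n => 1) (weitzenbockDerivation K (fun _ : Fin n => 1) p)) =
    (((Finsupp.weight (bidegreeWeight n) f).1 : K) - (Finsupp.weight (bidegreeWeight n) f).2) *
      coeff f p := by
  rw [commutator_apply, coeff_sub, coeff_sum, coeff_sum, weight_bidegreeWeight]
  simp only [coeff_X_mul_pderiv, ← Finset.sum_mul, ← sub_mul, Nat.cast_sum]

theorem bigradedSl2 :
    BigradedSl2 (bihomogeneous K n)
      (weitzenbockDerivation K (fun _ : Fin n => 1)).toLinearMap
      (dualDerivation K (fun _ : Fin n => 1)).toLinearMap where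
  map_E {a b v} hv := by
    rw [Derivation.coeFn_coe, weitzenbockDerivation_apply]
    refine Submodule.sum_mem _ fun k _ => ?_
    have h := (isWeightedHomogeneous_X K (bidegreeWeight n) ⟨k, 0⟩).mul
      (IsWeightedHomogeneous.pderiv (i := ⟨k, 1⟩) (n' := (a, b)) hv
        (by rw [bidegreeWeight_one]; simp))
    have e : ((1, 0) : ℕ × ℕ) + (a, b) = (a + 1, b) := by ext <;> simp [add_comm]
    rw [bidegreeWeight_zero, e] at h
    exact h
  E_zero {a v} hv := by
    rw [Derivation.coeFn_coe, weitzenbockDerivation_apply]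
    refine Finset.sum_eq_zero fun k _ => ?_
    rw [pderiv_eq_zero_of_weight K hv _ (by rw [bidegreeWeight_one]; simp), mul_zero]
  map_F {a b v} hv := by
    rw [Derivation.coeFn_coe, dualDerivation_apply]
    refine Submodule.sum_mem _ fun k _ => ?_
    have h := (isWeightedHomogeneous_X K (bidegreeWeight n) ⟨k, 1⟩).mul
      (IsWeightedHomogeneous.pderiv (i := ⟨k, 0⟩) (n' := (a, b)) hv
        (by rw [bidegreeWeight_zero]; simp))
    have e : ((0, 1) : ℕ × ℕ) + (a, b) = (a, b + 1) := by ext <;> simp [add_comm]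
    rw [bidegreeWeight_one, e] at h
    exact h
  F_zero {b v} hv := by
    rw [Derivation.coeFn_coe, dualDerivation_apply]
    refine Finset.sum_eq_zero fun k _ => ?_
    rw [pderiv_eq_zero_of_weight K hv _ (by rw [bidegreeWeight_zero]; simp), mul_zero]
  comm {a b v} hv := by
    ext f
    refine (coeff_commutator K v f).trans ?_
    rw [coeff_smul, smul_eq_mul]
    by_cases hf : coeff f v = 0
    · simp [hf]
    · rw [hv hf]

/-- The exponents of bidegree `(a, b)`, as pairs of multisets. -/
noncomputable def bidegreeEquiv (n a b : ℕ) :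
    {f : LinVars n →₀ ℕ | Finsupp.weight (bidegreeWeight n) f = (a, b)} ≃
      Sym (Fin n) a × Sym (Fin n) b :=
  Equiv.trans
    { toFun := fun f =>
        (⟨Finsupp.equivFunOnFinite.symm fun k => f.1 ⟨k, 0⟩,
          (Finsupp.sum_fintype _ _ fun _ => rfl).trans
            (congrArg Prod.fst ((weight_bidegreeWeight f.1).symm.trans f.2))⟩,
        ⟨Finsupp.equivFunOnFinite.symm fun k => f.1 ⟨k, 1⟩,
          (Finsupp.sum_fintype _ _ fun _ => rfl).trans
            (congrArg Prod.snd ((weight_bidegreeWeight f.1).symm.trans f.2))⟩)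
      invFun := fun g =>
        ⟨Finsupp.equivFunOnFinite.symm fun v => if v.2 = 0 then g.1.1 v.1 else g.2.1 v.1,
          (weight_bidegreeWeight _).trans (Prod.ext
            ((Finsupp.sum_fintype g.1.1 _ fun _ => rfl).symm.trans g.1.2)
            ((Finsupp.sum_fintype g.2.1 _ fun _ => rfl).symm.trans g.2.2))⟩
      left_inv := fun f => by
        ext ⟨k, i⟩
        fin_cases i <;> rfl
      right_inv := fun g => by
        ext <;> rfl }
    ((Sym.equivNatSum (Fin n) a).symm.prodCongr (Sym.equivNatSum (Fin n) b).symm)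

/-- A basis of the bihomogeneous part, indexed by the exponents. -/
noncomputable def bihomogeneousEquiv (n a b : ℕ) :
    bihomogeneous K n a b ≃ₗ[K] ((Sym (Fin n) a × Sym (Fin n) b) →₀ K) :=
  (LinearEquiv.ofEq _ _ (weightedHomogeneousSubmodule_eq_finsupp_supported K _ _)).trans
    ((AddMonoidAlgebra.supportedEquivFinsupp _).trans
      (Finsupp.domLCongr (bidegreeEquiv n a b)))

instance (a b : ℕ) : Module.Finite K (bihomogeneous K n a b) :=
  Module.Finite.equiv (bihomogeneousEquiv K n a b).symm

theorem finrank_bihomogeneous (n a b : ℕ) :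
    Module.finrank K (bihomogeneous K n a b) = n.multichoose a * n.multichoose b := by
  rw [(bihomogeneousEquiv K n a b).finrank_eq, Module.finrank_finsupp_self, Fintype.card_prod,
    Sym.card_sym_eq_multichoose, Sym.card_sym_eq_multichoose, Fintype.card_fin]

end JointInvariants

/-! ### Dimensions of the graded pieces. -/

namespace JointInvariants

open MvPolynomial

section Dimensions

variable {n : ℕ} (K : Type*) [Field K]

theorem bihomogeneous_le_homogeneous (a b : ℕ) :
    bihomogeneous K n a b ≤ homogeneousSubmodule (LinVars n) K (a + b) := by
  intro v hv
  rw [mem_homogeneousSubmodule]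
  intro f hf
  have h : Finsupp.weight (bidegreeWeight n) f = (a, b) := hv hf
  exact (DFunLike.congr_fun Finsupp.degree_eq_weight_one f).symm.trans
    (by rw [degree_eq_weight, h])

theorem weight_mem_antidiagonal {m : ℕ} {v : MvPolynomial (LinVars n) K}
    (hv : v ∈ homogeneousSubmodule (LinVars n) K m) {f : LinVars n →₀ ℕ} (hf : coeff f v ≠ 0) :
    Finsupp.weight (bidegreeWeight n) f ∈ Finset.HasAntidiagonal.antidiagonal m := by
  have h := (DFunLike.congr_fun Finsupp.degree_eq_weight_one f).trans
    ((mem_homogeneousSubmodule _ _).1 hv hf)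
  rwa [degree_eq_weight, ← Finset.HasAntidiagonal.mem_antidiagonal] at h

theorem sum_antidiagonal_component {m : ℕ} {v : MvPolynomial (LinVars n) K}
    (hv : v ∈ homogeneousSubmodule (LinVars n) K m) :
    ∑ p ∈ Finset.HasAntidiagonal.antidiagonal m, weightedHomogeneousComponent (bidegreeWeight n) p v = v := by
  ext f
  simp only [coeff_sum, coeff_weightedHomogeneousComponent, Finset.sum_ite_eq]
  split_ifs with h
  · rfl
  · by_contra hne
    exact h (weight_mem_antidiagonal K hv (Ne.symm hne))

theorem component_mem (p : ℕ × ℕ) (v : MvPolynomial (LinVars n) K) :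
    weightedHomogeneousComponent (bidegreeWeight n) p v ∈ bihomogeneous K n p.1 p.2 :=
  weightedHomogeneousComponent_mem (bidegreeWeight n) v p

theorem weitzenbockDerivation_mem {a b : ℕ} {v : MvPolynomial (LinVars n) K}
    (hv : v ∈ bihomogeneous K n a (b + 1)) :
    weitzenbockDerivation K (fun _ : Fin n => 1) v ∈ bihomogeneous K n (a + 1) b :=
  (bigradedSl2 K).map_E hv

theorem weitzenbockDerivation_component_eq_zero {m : ℕ} {v : MvPolynomial (LinVars n) K}
    (hv : v ∈ homogeneousSubmodule (LinVars n) K m)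
    (h0 : weitzenbockDerivation K (fun _ : Fin n => 1) v = 0) {p : ℕ × ℕ}
    (hp : p ∈ Finset.HasAntidiagonal.antidiagonal m) :
    weitzenbockDerivation K (fun _ : Fin n => 1)
      (weightedHomogeneousComponent (bidegreeWeight n) p v) = 0 := by
  obtain ⟨a, b⟩ := p
  cases b with
  | zero => exact (bigradedSl2 K).E_zero (component_mem K (a, 0) v)
  | succ b =>
    rw [← sum_antidiagonal_component K hv, map_sum] at h0
    -- The derivation shifts bidegrees injectively, so only the component `(a, b + 1)` of `v`
    -- contributes in bidegree `(a + 1, b)`.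
    have h1 := congrArg (weightedHomogeneousComponent (bidegreeWeight n) (a + 1, b)) h0
    rw [map_sum, map_zero, Finset.sum_eq_single (a, b + 1)] at h1
    · rwa [weightedHomogeneousComponent_of_mem (weitzenbockDerivation_mem K
        (component_mem K (a, b + 1) v)), if_pos rfl] at h1
    · rintro ⟨c, d⟩ hcd hne
      cases d with
      | zero =>
        rw [show weitzenbockDerivation K (fun _ : Fin n => 1) _ = 0 from
          (bigradedSl2 K).E_zero (component_mem K (c, 0) v), map_zero]
      | succ d =>
        rw [weightedHomogeneousComponent_of_mem (weitzenbockDerivation_mem K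
          (component_mem K (c, d + 1) v)), if_neg]
        simpa [eq_comm] using hne
    · exact fun h => absurd hp h

theorem gradedPiece_semiInvariants (m : ℕ) :
    gradedPiece (semiInvariants K (fun _ : Fin n => 1)) m =
      LinearMap.ker (weitzenbockDerivation K (fun _ : Fin n => 1)).toLinearMap ⊓
        homogeneousSubmodule (LinVars n) K m := rfl

theorem finrank_semiInvariants_eq_sum (m : ℕ) :
    Module.finrank K (gradedPiece (semiInvariants K (fun _ : Fin n => 1)) m) =
      ∑ p ∈ Finset.HasAntidiagonal.antidiagonal m, Module.finrank K
        ↥(LinearMap.ker (weitzenbockDerivation K (fun _ : Fin n => 1)).toLinearMap ⊓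
          bihomogeneous K n p.1 p.2) := by
  rw [gradedPiece_semiInvariants]
  refine finrank_eq_sum_of_projections _ _ _
    (fun p => weightedHomogeneousComponent (bidegreeWeight n) p) ?_ ?_ ?_ ?_ ?_
  · intro p hp
    rw [← Finset.HasAntidiagonal.mem_antidiagonal.1 hp]
    exact inf_le_inf_left _ (bihomogeneous_le_homogeneous K _ _)
  · intro p hp v hv
    exact ⟨weitzenbockDerivation_component_eq_zero K hv.2 hv.1 hp, component_mem K p v⟩
  · intro p _ v hv
    rw [weightedHomogeneousComponent_of_mem hv.2, if_pos rfl]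
  · intro p _ q _ hpq v hv
    rw [weightedHomogeneousComponent_of_mem hv.2, if_neg hpq]
  · intro v hv
    exact sum_antidiagonal_component K hv.2

variable [CharZero K]

theorem finrank_semiInvariants (n m : ℕ) :
    Module.finrank K (gradedPiece (semiInvariants K (fun _ : Fin n => 1)) m) =
      n.multichoose (m - m / 2) * n.multichoose (m / 2) := by
  rw [finrank_semiInvariants_eq_sum, ← Finset.Nat.sum_antidiagonal_swap,
    Finset.Nat.sum_antidiagonal_eq_sum_range_succ_mk]
  -- The sum telescopes as long as `b ≤ m - b`; past `m / 2` the kernels vanish.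
  have key : ∀ t, 2 * t ≤ m → ∑ b ∈ Finset.range (t + 1), Module.finrank K
      ↥(LinearMap.ker (weitzenbockDerivation K (fun _ : Fin n => 1)).toLinearMap ⊓
          bihomogeneous K n (m - b) b) = n.multichoose (m - t) * n.multichoose t := by
    intro t
    induction t with
    | zero =>
      intro _
      rw [zero_add, Finset.sum_range_one, (bigradedSl2 K).ker_inf_zero, finrank_bihomogeneous]
    | succ t ih =>
      intro ht
      rw [Finset.sum_range_succ, ih (by omega), ← finrank_bihomogeneous K, ← finrank_bihomogeneous K,
        ← (bigradedSl2 K).finrank_ker_inf_add (by omega : t ≤ m - (t + 1)), add_comm,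
        show m - (t + 1) + 1 = m - t by omega]
  rw [← key (m / 2) (by omega)]
  symm
  refine Finset.sum_subset (Finset.range_subset_range.2 (by omega)) fun b hb hb' => ?_
  rw [Finset.mem_range] at hb hb'
  rw [(bigradedSl2 K).ker_inf_eq_bot (by omega), finrank_bot]

/-- The commutator kills an invariant, yet multiplies each coefficient by the difference of the two
partial degrees, which must be `0` in characteristic zero. -/
theorem weight_eq_of_mem_invariants {m : ℕ} {v : MvPolynomial (LinVars n) K}
    (hv : v ∈ gradedPiece (invariants K (fun _ : Fin n => 1)) m) {f : LinVars n →₀ ℕ}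
    (hf : coeff f v ≠ 0) : ∃ p, Finsupp.weight (bidegreeWeight n) f = (p, p) ∧ m = p + p := by
  obtain ⟨⟨hE, hF⟩, hm⟩ := hv
  have hE' : weitzenbockDerivation K (fun _ : Fin n => 1) v = 0 := hE
  have hF' : dualDerivation K (fun _ : Fin n => 1) v = 0 := hF
  have h := coeff_commutator K v f
  rw [hE', hF', map_zero, map_zero, sub_zero, coeff_zero, eq_comm,
    mul_eq_zero, or_iff_left hf, sub_eq_zero, Nat.cast_inj] at h
  have h2 := Finset.HasAntidiagonal.mem_antidiagonal.1 (weight_mem_antidiagonal K hm hf)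
  exact ⟨(Finsupp.weight (bidegreeWeight n) f).1, Prod.ext rfl h.symm, by omega⟩

theorem gradedPiece_invariants_even (p : ℕ) :
    gradedPiece (invariants K (fun _ : Fin n => 1)) (p + p) =
      LinearMap.ker (weitzenbockDerivation K (fun _ : Fin n => 1)).toLinearMap ⊓
        bihomogeneous K n p p := by
  ext v
  constructor
  · intro hv
    refine ⟨hv.1.1, fun f hf => ?_⟩
    obtain ⟨q, hq, hpq⟩ := weight_eq_of_mem_invariants K hv hf
    rw [hq, show q = p by omega]
  · intro hv
    exact ⟨⟨hv.1, (bigradedSl2 K).F_eq_zero_of_E_eq_zero hv.2 hv.1⟩,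
      bihomogeneous_le_homogeneous K p p hv.2⟩

theorem finrank_invariants_even (n q : ℕ) :
    Module.finrank K (gradedPiece (invariants K (fun _ : Fin n => 1)) (q + 1 + (q + 1))) +
      n.multichoose (q + 2) * n.multichoose q = n.multichoose (q + 1) * n.multichoose (q + 1) := by
  rw [gradedPiece_invariants_even, ← finrank_bihomogeneous K, ← finrank_bihomogeneous K]
  exact (bigradedSl2 K).finrank_ker_inf_add (by omega)

theorem finrank_invariants_zero (n : ℕ) :
    Module.finrank K (gradedPiece (invariants K (fun _ : Fin n => 1)) 0) = 1 := by
  rw [show 0 = 0 + 0 from rfl, gradedPiece_invariants_even, (bigradedSl2 K).ker_inf_zero,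
    finrank_bihomogeneous]
  simp

theorem finrank_invariants_odd (n p : ℕ) :
    Module.finrank K (gradedPiece (invariants K (fun _ : Fin n => 1)) (2 * p + 1)) = 0 := by
  have h : gradedPiece (invariants K (fun _ : Fin n => 1)) (2 * p + 1) = ⊥ := by
    refine (Submodule.eq_bot_iff _).2 fun v hv => ?_
    ext f
    by_contra hf
    obtain ⟨q, -, hq⟩ := weight_eq_of_mem_invariants K hv hf
    omega
  rw [h, finrank_bot]

end Dimensions

end JointInvariants

/-! ### Binomial identities and coefficients of the series. -/

namespace JointInvariants

open PowerSeries

section Series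

theorem coeff_one_sub_X_pow (p i : ℕ) :
    coeff i ((1 - X : PowerSeries ℚ) ^ p) = (-1) ^ i * (p.choose i : ℚ) := by
  have h : (1 - X : PowerSeries ℚ) ^ p =
      rescale (-1) (((1 + Polynomial.X : Polynomial ℚ) ^ p : Polynomial ℚ) : PowerSeries ℚ) := by
    simp [sub_eq_add_neg, rescale_X]
  rw [h, coeff_rescale, Polynomial.coeff_coe, Polynomial.coeff_one_add_X_pow]

/-- Coefficient of `X ^ N` in `(1 - X)^p (1 - X)^{-(p+q+1)} = (1 - X)^{-(q+1)}`. -/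
theorem sum_alternating_choose (p q N : ℕ) :
    ∑ i ∈ Finset.range (N + 1), (-1 : ℚ) ^ i * p.choose i * (p + q + N - i).choose (N - i) =
      (q + N).choose N := by
  have h := congrArg (coeff N) (one_sub_pow_mul_invOneSubPow_val_add_eq_invOneSubPow_val ℚ (q + 1) p)
  rw [show q + 1 + p = p + q + 1 by ring, invOneSubPow_val_succ_eq_mk_add_choose,
    invOneSubPow_val_succ_eq_mk_add_choose, coeff_mk, coeff_mul,
    Finset.Nat.sum_antidiagonal_eq_sum_range_succ_mk, Nat.choose_symm_add] at h
  rw [← h]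
  refine Finset.sum_congr rfl fun i hi => ?_
  rw [Finset.mem_range] at hi
  rw [coeff_one_sub_X_pow, coeff_mk, Nat.choose_symm_add,
    show p + q + N - i = p + q + (N - i) by omega]

theorem sum_alternating_choose_mul {p m : ℕ} (hp : p ≤ m) (N : ℕ) :
    ∑ i ∈ Finset.range (N + 1), (-1 : ℚ) ^ i * (N + i).choose i * (m + (N - i)).choose (N - i) *
      (N + p).choose (N + i) = (N + p).choose N * (N + (m - p)).choose N := by
  rw [add_comm N (m - p), ← sum_alternating_choose p, Finset.mul_sum]
  refine Finset.sum_congr rfl fun i hi => ?_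
  rw [Finset.mem_range] at hi
  -- Trinomial revision takes `(N + p).choose N` out of the sum and leaves `p.choose i`.
  have h := Nat.choose_mul (n := N + p) (k := N + i) (s := N) (by omega)
  rw [Nat.add_sub_cancel_left, Nat.add_sub_cancel_left, Nat.choose_symm_add] at h
  have h' : ((N + p).choose (N + i) : ℚ) * (N + i).choose i = (N + p).choose N * p.choose i := by
    exact_mod_cast h
  rw [show p + (m - p) + N - i = m + (N - i) by omega]
  linear_combination (-1 : ℚ) ^ i * (m + (N - i)).choose (N - i) * h'

theorem inv_one_sub_X_sq_pow (r : ℕ) :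
    ((1 - X ^ 2 : PowerSeries ℚ) ^ (r + 1))⁻¹ =
      expand 2 two_ne_zero (mk fun j => ((r + j).choose r : ℚ)) := by
  rw [eq_comm, PowerSeries.eq_inv_iff_mul_eq_one (by simp)]
  have h := congrArg (expand 2 two_ne_zero) (mk_add_choose_mul_one_sub_pow_eq_one ℚ r)
  simpa using h

theorem coeff_one_add_X_mul_expand (g : PowerSeries ℚ) (t : ℕ) :
    coeff t ((1 + X) * expand 2 two_ne_zero g) = coeff (t / 2) g := by
  rw [add_mul, one_mul, map_add]
  obtain ⟨s, rfl | rfl⟩ := t.even_or_odd'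
  · rw [coeff_expand_mul, Nat.mul_div_cancel_left _ two_pos, add_eq_left]
    cases s with
    | zero => simp
    | succ s =>
      rw [show 2 * (s + 1) = 2 * s + 1 + 1 by ring, coeff_succ_X_mul,
        coeff_expand_of_not_dvd _ _ _ (by omega)]
  · rw [coeff_succ_X_mul, coeff_expand_mul, coeff_expand_of_not_dvd _ _ _ (by omega), zero_add]
    congr 2
    omega

theorem coeff_shift {N i : ℕ} (hi : i ≤ N) (m : ℕ) (g : PowerSeries ℚ) :
    coeff (m + (N - i)) (X ^ (N + i) * g) = if 2 * i ≤ m then coeff (m - 2 * i) g else 0 := by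
  rw [coeff_X_pow_mul']
  split_ifs with h1 h2 h2
  · congr 2; omega
  · omega
  · omega
  · rfl

theorem coeff_semi_summand {N i : ℕ} (hi : i ≤ N) (m : ℕ) :
    coeff (m + (N - i)) ((1 + (X : PowerSeries ℚ)) * X ^ (N + i) *
      ((1 - X ^ 2) ^ (N + i + 1))⁻¹) = ((N + m / 2).choose (N + i) : ℚ) := by
  rw [mul_comm (1 + X : PowerSeries ℚ), mul_assoc (X ^ (N + i)), coeff_shift hi, inv_one_sub_X_sq_pow,
    coeff_one_add_X_mul_expand, coeff_mk]
  split_ifs with h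
  · congr 2; omega
  · rw [Nat.choose_eq_zero_of_lt (by omega), Nat.cast_zero]

/-- Splitting off one factor `1 - X ^ 2` leaves the exponent `e + 1`, which covers `e = 0` and makes
the coefficients differences of consecutive binomials. -/
theorem X_mul_inv_pow (e : ℕ) :
    ((X : PowerSeries ℚ) * (1 - X ^ 2)⁻¹) ^ e =
      X ^ e * expand 2 two_ne_zero ((1 - X) * mk fun j => ((e + j).choose e : ℚ)) := by
  rw [map_mul, ← inv_one_sub_X_sq_pow, mul_pow, map_sub, map_one, expand_X]
  congr 1
  have h : (1 - X ^ 2 : PowerSeries ℚ) * (1 - X ^ 2)⁻¹ = 1 := PowerSeries.mul_inv_cancel _ (by simp)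
  rw [PowerSeries.eq_mul_inv_iff_mul_eq (by simp), pow_succ (1 - X ^ 2) e,
    ← mul_assoc, ← mul_pow, mul_comm _ (1 - X ^ 2), mul_comm _ (1 - X ^ 2), h,
    one_pow, mul_one]

theorem coeff_inv_summand_odd {N i : ℕ} (hi : i ≤ N) (p : ℕ) :
    coeff (2 * p + 1 + (N - i)) (((X : PowerSeries ℚ) * (1 - X ^ 2)⁻¹) ^ (N + i)) = 0 := by
  rw [X_mul_inv_pow, coeff_shift hi]
  split_ifs with h
  · exact coeff_expand_of_not_dvd _ _ _ (by omega)
  · rfl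

theorem coeff_inv_summand_succ {N i : ℕ} (hi : i ≤ N) (q : ℕ) :
    coeff (2 * (q + 1) + (N - i)) (((X : PowerSeries ℚ) * (1 - X ^ 2)⁻¹) ^ (N + i)) =
      ((N + (q + 1)).choose (N + i) : ℚ) - ((N + q).choose (N + i) : ℚ) := by
  rw [X_mul_inv_pow, coeff_shift hi, ← Nat.mul_sub, coeff_expand_mul, sub_mul, one_mul, map_sub,
    coeff_mk]
  split_ifs with h
  · rw [show N + i + (q + 1 - i) = N + (q + 1) by omega]
    congr 1
    rcases Nat.lt_or_ge q i with hq | hq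
    · rw [show q + 1 - i = 0 by omega, coeff_zero_X_mul, Nat.choose_eq_zero_of_lt (by omega),
        Nat.cast_zero]
    · rw [show q + 1 - i = q - i + 1 by omega, coeff_succ_X_mul, coeff_mk,
        show N + i + (q - i) = N + q by omega]
  · rw [Nat.choose_eq_zero_of_lt (by omega), Nat.choose_eq_zero_of_lt (by omega), Nat.cast_zero,
      sub_zero]

theorem coeff_inv_summand_zero {N i : ℕ} (hi : i ≤ N) :
    coeff (0 + (N - i)) (((X : PowerSeries ℚ) * (1 - X ^ 2)⁻¹) ^ (N + i)) =
      ((N + 0).choose (N + i) : ℚ) := by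
  rw [X_mul_inv_pow, coeff_shift hi]
  rcases Nat.eq_zero_or_pos i with rfl | h
  · simp
  · rw [if_neg (by omega), Nat.choose_eq_zero_of_lt (by omega), Nat.cast_zero]

/-- The coefficients of the differentiated sums, in terms of `i = n - k` and `N = n - 1`. -/
theorem coeff_sum_derivative (N m : ℕ) (f : ℕ → PowerSeries ℚ) :
    coeff m (∑ k ∈ Finset.Icc 1 (N + 1),
      ((-1 : ℚ) ^ (N + 1 - k) / ((k - 1).factorial : ℚ) *
        (((N + 1).ascFactorial (N + 1 - k) : ℚ) / ((N + 1 - k).factorial : ℚ))) •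
        (derivative ℚ)^[k - 1] (f k)) =
    ∑ i ∈ Finset.range (N + 1), (-1 : ℚ) ^ i * (N + i).choose i * (m + (N - i)).choose (N - i) *
      coeff (m + (N - i)) (f (N + 1 - i)) := by
  rw [map_sum]
  refine Finset.sum_nbij' (fun k => N + 1 - k) (fun i => N + 1 - i) ?_ ?_ ?_ ?_ ?_
  · intro k hk
    rw [Finset.mem_Icc] at hk
    rw [Finset.mem_range]
    omega
  · intro i hi
    rw [Finset.mem_range] at hi
    rw [Finset.mem_Icc]
    omega
  · intro k hk
    rw [Finset.mem_Icc] at hk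
    omega
  · intro i hi
    rw [Finset.mem_range] at hi
    omega
  · intro k hk
    rw [Finset.mem_Icc] at hk
    obtain ⟨j, rfl⟩ := Nat.exists_eq_add_of_le' hk.1
    have hj : j ≤ N := by omega
    -- Both rising factorials, from the iterated derivative and from `(n)_{n-k}`, are a factorial
    -- times a binomial; the factorials cancel the denominators.
    rw [Nat.add_sub_add_right, Nat.sub_sub_self hj, show N + 1 - (N - j) = j + 1 by omega,
      Nat.add_sub_cancel, coeff_smul, coeff_iterate_derivative,
      Nat.ascFactorial_eq_factorial_mul_choose, Nat.ascFactorial_eq_factorial_mul_choose]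
    have h1 : (j.factorial : ℚ) ≠ 0 := Nat.cast_ne_zero.2 (Nat.factorial_ne_zero _)
    have h2 : ((N - j).factorial : ℚ) ≠ 0 := Nat.cast_ne_zero.2 (Nat.factorial_ne_zero _)
    push_cast
    rw [smul_eq_mul]
    field_simp

theorem multichoose_succ_eq_choose (N a : ℕ) : (N + 1).multichoose a = (N + a).choose N := by
  rw [Nat.multichoose_eq, Nat.choose_symm_add, show N + 1 + a - 1 = N + a by omega]

end Series

end JointInvariants

/-! ### Comparison of coefficients. -/

theorem theorem4p1 (K : Type*) [Field K] [CharZero K] (n : ℕ) (hn : 1 ≤ n) :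
    JointInvariants.PI K (fun _ : Fin n => 1) =
        ∑ k ∈ Finset.Icc 1 n,
          ((-1 : ℚ) ^ (n - k) / ((k - 1).factorial : ℚ) *
              ((n.ascFactorial (n - k) : ℚ) / ((n - k).factorial : ℚ))) •
            (PowerSeries.derivative ℚ)^[k - 1]
              (((PowerSeries.X : PowerSeries ℚ) * (1 - PowerSeries.X ^ 2)⁻¹) ^ (2 * n - k - 1)) ∧
      JointInvariants.PS K (fun _ : Fin n => 1) =
        ∑ k ∈ Finset.Icc 1 n,
          ((-1 : ℚ) ^ (n - k) / ((k - 1).factorial : ℚ) *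
              ((n.ascFactorial (n - k) : ℚ) / ((n - k).factorial : ℚ))) •
            (PowerSeries.derivative ℚ)^[k - 1]
              ((1 + (PowerSeries.X : PowerSeries ℚ)) * PowerSeries.X ^ (2 * n - k - 1) *
                ((1 - PowerSeries.X ^ 2) ^ (2 * n - k))⁻¹) := by
  obtain ⟨N, rfl⟩ := Nat.exists_eq_add_of_le' hn
  constructor
  · ext m
    rw [JointInvariants.coeff_sum_derivative, JointInvariants.PI, JointInvariants.poincareSeries,
      PowerSeries.coeff_mk]
    have hterm : ∀ i ∈ Finset.range (N + 1), 2 * (N + 1) - (N + 1 - i) - 1 = N + i := by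
      intro i hi
      rw [Finset.mem_range] at hi
      omega
    rw [Finset.sum_congr rfl fun i hi => by rw [hterm i hi]]
    obtain ⟨p, rfl | rfl⟩ := m.even_or_odd'
    · cases p with
      | zero =>
        rw [mul_zero, JointInvariants.finrank_invariants_zero]
        have h := JointInvariants.sum_alternating_choose_mul (le_refl 0) N
        rw [add_zero, Nat.sub_zero, add_zero, Nat.choose_self] at h
        rw [Nat.cast_one, mul_one] at h
        rw [Nat.cast_one]
        refine h.symm.trans (Finset.sum_congr rfl fun i hi => ?_)
        rw [JointInvariants.coeff_inv_summand_zero (Nat.lt_succ_iff.1 (Finset.mem_range.1 hi)),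
          add_zero]
      | succ q =>
        have h := JointInvariants.finrank_invariants_even K (N + 1) q
        rw [← two_mul] at h
        simp only [JointInvariants.multichoose_succ_eq_choose] at h
        have h' := congrArg (Nat.cast : ℕ → ℚ) h
        push_cast at h'
        -- The two products in the dimension formula come from the same `m` with `p = q + 1` and `p
        -- = q`, so their sums subtract term by term.
        have h1 := JointInvariants.sum_alternating_choose_mul (p := q + 1) (m := 2 * (q + 1))
          (by omega) N
        have h2 := JointInvariants.sum_alternating_choose_mul (p := q) (m := 2 * (q + 1))
          (by omega) N
        rw [show 2 * (q + 1) - (q + 1) = q + 1 by omega] at h1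
        rw [show 2 * (q + 1) - q = q + 2 by omega] at h2
        rw [eq_sub_of_add_eq h', ← h1, mul_comm ((N + (q + 2)).choose N : ℚ), ← h2,
          ← Finset.sum_sub_distrib]
        refine Finset.sum_congr rfl fun i hi => ?_
        rw [JointInvariants.coeff_inv_summand_succ (Nat.lt_succ_iff.1 (Finset.mem_range.1 hi)),
          mul_sub]
    · rw [JointInvariants.finrank_invariants_odd, Nat.cast_zero, eq_comm]
      refine Finset.sum_eq_zero fun i hi => ?_
      rw [JointInvariants.coeff_inv_summand_odd (Nat.lt_succ_iff.1 (Finset.mem_range.1 hi)),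
        mul_zero]
  · ext m
    rw [JointInvariants.coeff_sum_derivative, JointInvariants.PS, JointInvariants.poincareSeries,
      PowerSeries.coeff_mk, JointInvariants.finrank_semiInvariants, mul_comm,
      JointInvariants.multichoose_succ_eq_choose, JointInvariants.multichoose_succ_eq_choose,
      Nat.cast_mul, ← JointInvariants.sum_alternating_choose_mul (Nat.div_le_self m 2)]
    refine Finset.sum_congr rfl fun i hi => ?_
    have hi' := Nat.lt_succ_iff.1 (Finset.mem_range.1 hi)
    rw [show 2 * (N + 1) - (N + 1 - i) = N + i + 1 by omega, Nat.add_sub_cancel,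
      JointInvariants.coeff_semi_summand hi']
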